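/- Fix a countable set $\mathsf{Prop}$ of propositional variables, and let formulas be built from the variables and the constant $\bot$ by the binary connectives $\land,\lor,\to,\supset$. Let $\mathbf{S}^-_\bot$ be the Hilbert system whose axioms are all instances of the following schemata: - $\bot\to A$; - $A\to(B\to A)$; - $(A\to(B\to C))\to((A\to B)\to(A\to C))$; - $(A\land B)\to A$; - $(A\land B)\to B$; - $(C\to A)\to((C\to B)\to(C\to(A\land B)))$; - $A\to(A\lor B)$; - $B\to(A\lor B)$; - $(A\to C)\to((B\to C)\to((A\lor B)\to C))$; - $(A\to B)\supset(A\supset B)$; - $(A\supset(B\supset C))\to((A\supset B)\supset(A\supset C))$; - $(A\supset(B\to C))\to(B\to(A\supset C))$; - $(A\to(B\supset C))\to(B\supset(A\to C))$; - $((A\supset B)\supset C)\to((A\supset C)\to C)$; and whose only rule is: from $A$ and $A\supset B$ infer $B$. Write $\mathbf{S}^-_\bot\vdash A$ if $A$ has a derivation without premises in this system. An $\mathbf{S}^-_\bot$-model is a triple $\langle W,\le,V\rangle$, where $W$ is a non-empty set, $\le$ is a reflexive and transitive relation on $W$, and $V:W\times\mathsf{Prop}\to\{0,1\}$ is such that $V(w_1,p)=1$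 and $w_1\le w_2$ imply $V(w_2,p)=1$. (No least element is required.) $V$ is extended to an interpretation $I$ of state-formula pairs by: - $I(w,p)=V(w,p)$; - $I(w,\bot)=0$; - $I(w,A\land B)=1$ iff $I(w,A)=1$ and $I(w,B)=1$; - $I(w,A\lor B)=1$ iff $I(w,A)=1$ or $I(w,B)=1$; - $I(w,A\to B)=1$ iff for all $x\in W$ with $w\le x$, $I(x,A)=1$ implies $I(x,B)=1$; - $I(w,A\supset B)=1$ iff $I(x,A)\ne 1$ for some $x\in W$, or $I(w,B)=1$. Write $\models_\supset A$ if $I(w,A)=1$ for all states $w$ of all $\mathbf{S}^-_\bot$-models. **Theorem.** For every formula $A$, $\mathbf{S}^-_\bot\vdash A$ if and only if $\models_\supset A$. -/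

import Mathlib

universe u

namespace SMinusBot

/-- Formulas over the propositional variables `Var`, built with absurdity, conjunction,
disjunction, the intuitionistic conditional `imp` and the classical conditional `mat`. -/
inductive Form (Var : Type) : Type where
  | var : Var → Form Var
  | bot : Form Var
  | and : Form Var → Form Var → Form Var
  | or : Form Var → Form Var → Form Var
  | imp : Form Var → Form Var → Form Var
  | mat : Form Var → Form Var → Form Var

infixl:70 " ⩑ " => Form.and
infixl:65 " ⩒ " => Form.or
infixr:60 " ⇾ " => Form.imp
infixr:60 " ⊃ₘ " => Form.mat

/-- The instances of the axiom schemata of the system. -/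
inductive Axm {Var : Type} : Form Var → Prop where
  | ax0 (A : Form Var) : Axm (Form.bot ⇾ A)
  | ax1 (A B : Form Var) : Axm (A ⇾ (B ⇾ A))
  | ax2 (A B C : Form Var) : Axm ((A ⇾ (B ⇾ C)) ⇾ ((A ⇾ B) ⇾ (A ⇾ C)))
  | ax3 (A B : Form Var) : Axm ((A ⩑ B) ⇾ A)
  | ax4 (A B : Form Var) : Axm ((A ⩑ B) ⇾ B)
  | ax5 (A B C : Form Var) : Axm ((C ⇾ A) ⇾ ((C ⇾ B) ⇾ (C ⇾ (A ⩑ B))))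
  | ax6 (A B : Form Var) : Axm (A ⇾ (A ⩒ B))
  | ax7 (A B : Form Var) : Axm (B ⇾ (A ⩒ B))
  | ax8 (A B C : Form Var) : Axm ((A ⇾ C) ⇾ ((B ⇾ C) ⇾ ((A ⩒ B) ⇾ C)))
  | axM1 (A B : Form Var) : Axm ((A ⇾ B) ⊃ₘ (A ⊃ₘ B))
  | axM2 (A B C : Form Var) : Axm ((A ⊃ₘ (B ⊃ₘ C)) ⇾ ((A ⊃ₘ B) ⊃ₘ (A ⊃ₘ C)))
  | axM3 (A B C : Form Var) : Axm ((A ⊃ₘ (B ⇾ C)) ⇾ (B ⇾ (A ⊃ₘ C)))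
  | axM4 (A B C : Form Var) : Axm ((A ⇾ (B ⊃ₘ C)) ⇾ (B ⊃ₘ (A ⇾ C)))
  | axM5 (A B C : Form Var) : Axm (((A ⊃ₘ B) ⊃ₘ C) ⇾ ((A ⊃ₘ C) ⇾ C))

/-- `Derives Γ A`: there is a derivation of `A` from the premises `Γ`. The only rule of inference
is modus ponens for the classical conditional. -/
inductive Derives {Var : Type} (Γ : Set (Form Var)) : Form Var → Prop where
  | prem {A : Form Var} : A ∈ Γ → Derives Γ A
  | ax {A : Form Var} : Axm A → Derives Γ A
  | mp {A B : Form Var} : Derives Γ A → Derives Γ (A ⊃ₘ B) → Derives Γ B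

/-- `A` is a theorem of the system. -/
def Provable {Var : Type} (A : Form Var) : Prop := Derives ∅ A

/-- A Kripke model without a base state: a non-empty set of states, a reflexive and transitive
relation on it, and a persistent valuation (`V w p` means that `p` has value 1 at `w`). -/
structure Model (Var : Type) : Type (u + 1) where
  W : Type u
  nonempty : Nonempty W
  le : W → W → Prop
  le_refl : ∀ w, le w w
  le_trans : ∀ w₁ w₂ w₃, le w₁ w₂ → le w₂ w₃ → le w₁ w₃
  V : W → Var → Prop
  persistent : ∀ w₁ w₂ p, V w₁ p → le w₁ w₂ → V w₂ p

/-- `M.Holds w A`: the interpretation gives `A` the value 1 at the state `w`. -/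
def Model.Holds {Var : Type} (M : Model.{u} Var) : M.W → Form Var → Prop
  | w, .var p => M.V w p
  | _, .bot => False
  | w, .and A B => M.Holds w A ∧ M.Holds w B
  | w, .or A B => M.Holds w A ∨ M.Holds w B
  | w, .imp A B => ∀ x, M.le w x → M.Holds x A → M.Holds x B
  | w, .mat A B => (∃ x, ¬ M.Holds x A) ∨ M.Holds w B

/-- Semantic consequence: in every model in which all members of `Γ` hold at all states,
`A` holds at all states. -/
def Entails {Var : Type} (Γ : Set (Form Var)) (A : Form Var) : Prop :=
  ∀ M : Model.{u} Var, (∀ B ∈ Γ, ∀ w, M.Holds w B) → ∀ w, M.Holds w A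

/-- `A` holds at every state of every model. -/
def Valid {Var : Type} (A : Form Var) : Prop := Entails.{u} ∅ A

end SMinusBot

namespace SMinusBot

variable {Var : Type}

/-! ### Soundness -/

/-! Soundness is a check of the axioms. Completeness uses Zorn twice, at two levels. Given an
unprovable `A`, take a `⊃ₘ`-theory `Δ` maximal among those omitting `A`; it plays the role of the
set of formulas true at every state. The states are the consistent prime `⇾`-theories over `Δ`; they
need not be closed under `⊃ₘ`. A formula outside `Δ` is missed by some state
(`IsTheory.exists_prime`), so "the antecedent fails somewhere" means "it is not in `Δ`", and
`IsTheory.mat_mem_of_notMem` then makes `⊃ₘ` behave classically. -/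

theorem Model.Holds.mono (M : Model.{u} Var) (A : Form Var) :
    ∀ {w x : M.W}, M.le w x → M.Holds w A → M.Holds x A := by
  induction A with
  | var p => exact fun h hw => M.persistent _ _ p hw h
  | bot => exact fun _ hw => hw
  | and A B ihA ihB => exact fun h hw => ⟨ihA h hw.1, ihB h hw.2⟩
  | or A B ihA ihB => exact fun h hw => hw.imp (ihA h) (ihB h)
  | imp A B _ _ => exact fun h hw y hxy => hw y (M.le_trans _ _ _ h hxy)
  | mat A B _ ihB => exact fun h hw => hw.imp_right (ihB h)

theorem Axm.holds {A : Form Var} (hA : Axm A) (M : Model.{u} Var) (w : M.W) : M.Holds w A := by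
  cases hA with
  | ax0 A => exact fun x _ h => h.elim
  | ax1 A B => exact fun x _ hA y hxy _ => hA.mono M A hxy
  | ax2 A B C =>
    exact fun x _ h y hxy h' z hyz hA =>
      h z (M.le_trans _ _ _ hxy hyz) hA z (M.le_refl z) (h' z hyz hA)
  | ax3 A B => exact fun x _ h => h.1
  | ax4 A B => exact fun x _ h => h.2
  | ax5 A B C =>
    exact fun x _ h y hxy h' z hyz hC => ⟨h z (M.le_trans _ _ _ hxy hyz) hC, h' z hyz hC⟩
  | ax6 A B => exact fun x _ h => Or.inl h
  | ax7 A B => exact fun x _ h => Or.inr h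
  | ax8 A B C =>
    exact fun x _ h y hxy h' z hyz hAB =>
      hAB.elim (h z (M.le_trans _ _ _ hxy hyz)) (h' z hyz)
  | axM1 A B =>
    by_cases h : ∃ x, ¬ M.Holds x A
    · exact Or.inr (Or.inl h)
    · by_cases h' : M.Holds w B
      · exact Or.inr (Or.inr h')
      -- Here `A` holds everywhere and `B` fails at `w`, so `A ⇾ B` fails at `w`; one failing state
      -- suffices.
      · exact Or.inl ⟨w, fun hAB => h' (hAB w (M.le_refl w) (not_exists_not.mp h w))⟩
  | axM2 A B C =>
    rintro x - (h | ⟨y, hy⟩ | h)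
    · exact Or.inr (Or.inl h)
    · by_cases hA : ∃ z, ¬ M.Holds z A
      · exact Or.inr (Or.inl hA)
      · exact Or.inl ⟨y, fun h => h.elim hA hy⟩
    · exact Or.inr (Or.inr h)
  | axM3 A B C =>
    exact fun x _ h y hxy hB => h.imp_right fun h => h y hxy hB
  | axM4 A B C =>
    intro x _ h
    by_cases hB : ∃ z, ¬ M.Holds z B
    · exact Or.inl hB
    · exact Or.inr fun y hxy hA => (h y hxy hA).resolve_left hB
  | axM5 A B C =>
    rintro x - (⟨y, hy⟩ | h) z hxz h'
    · refine h'.resolve_left ?_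
      rintro ⟨v, hv⟩
      exact hy (Or.inl ⟨v, hv⟩)
    · exact h.mono M C hxz

theorem Provable.valid {A : Form Var} (hA : Provable A) : Valid.{u} A := by
  intro M _
  induction hA with
  | prem h => exact h.elim
  | ax h => exact h.holds M
  | mp _ _ ihA ihAB =>
    -- The rule preserves truth throughout a model, not truth at a single state.
    exact fun w => (ihAB w).resolve_left fun ⟨x, hx⟩ => hx (ihA x)

/-! ### Theories -/

/-- `T` contains `Δ` and is closed under modus ponens for the connective `c`. -/
structure IsTheory (c : Form Var → Form Var → Form Var) (Δ T : Set (Form Var)) : Prop where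
  subset : Δ ⊆ T
  mp : ∀ {A B}, A ∈ T → c A B ∈ T → B ∈ T

/-- A theory omitting `A` extends to a theory that is maximal among those omitting `A`. -/
theorem IsTheory.exists_maximal {c : Form Var → Form Var → Form Var} {Δ T : Set (Form Var)}
    (hT : IsTheory c Δ T) {A : Form Var} (hA : A ∉ T) :
    ∃ S, T ⊆ S ∧ IsTheory c Δ S ∧ A ∉ S ∧ ∀ U, IsTheory c Δ U → S ⊆ U → A ∉ U → U = S := by
  obtain ⟨S, hTS, hS⟩ := zorn_subset_nonempty {S | IsTheory c Δ S ∧ A ∉ S} (by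
    rintro C hC hchain ⟨S₀, hS₀⟩
    refine ⟨⋃₀ C, ⟨⟨fun B hB => ⟨S₀, hS₀, (hC hS₀).1.subset hB⟩, ?_⟩, ?_⟩,
      fun S hS => Set.subset_sUnion_of_mem hS⟩
    · rintro B D ⟨S₁, h₁, hB⟩ ⟨S₂, h₂, hBD⟩
      rcases hchain.total h₁ h₂ with h | h
      · exact ⟨S₂, h₂, (hC h₂).1.mp (h hB) hBD⟩
      · exact ⟨S₁, h₁, (hC h₁).1.mp hB (h hBD)⟩
    · rintro ⟨S, hS, hAS⟩
      exact (hC hS).2 hAS) T ⟨hT, hA⟩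
  exact ⟨S, hTS, hS.prop.1, hS.prop.2, fun U hU hSU hAU =>
    (hS.le_of_ge ⟨hU, hAU⟩ hSU).antisymm hSU⟩

theorem isTheory_provable : IsTheory Form.mat {A : Form Var | Axm A} {A | Provable A} :=
  ⟨fun _ h => .ax h, fun hA hAB => .mp hA hAB⟩

theorem IsTheory.imp_mp {T : Set (Form Var)} (hT : IsTheory Form.mat {A | Axm A} T)
    {A B : Form Var} (hA : A ∈ T) (hAB : (A ⇾ B) ∈ T) : B ∈ T :=
  hT.mp hA (hT.mp hAB (hT.subset (.axM1 A B)))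

theorem IsTheory.imp_self_mem {T : Set (Form Var)} (hT : IsTheory Form.mat {A | Axm A} T)
    (A : Form Var) : (A ⇾ A) ∈ T :=
  hT.imp_mp (hT.subset (.ax1 A A))
    (hT.imp_mp (hT.subset (.ax1 A (A ⇾ A))) (hT.subset (.ax2 A (A ⇾ A) A)))

theorem IsTheory.mat_mem {T : Set (Form Var)} (hT : IsTheory Form.mat {A | Axm A} T)
    {A : Form Var} (B : Form Var) (hA : A ∈ T) : (B ⊃ₘ A) ∈ T :=
  hT.mp (hT.imp_mp hA (hT.subset (.ax1 A B))) (hT.subset (.axM1 B A))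

/-- The formulas that follow from `B` by `⊃ₘ` over a theory form a theory. -/
theorem IsTheory.adjoin_mat {T : Set (Form Var)} (hT : IsTheory Form.mat {A | Axm A} T)
    (B : Form Var) : IsTheory Form.mat {A | Axm A} {A | (B ⊃ₘ A) ∈ T} where
  subset _ hA := hT.mat_mem B (hT.subset hA)
  mp {A C} hA hAC := hT.mp hA (hT.imp_mp hAC (hT.subset (.axM2 B A C)))

/-- A theory that is maximal among those omitting `A` interprets `⊃ₘ` classically. -/
theorem IsTheory.mat_mem_of_notMem {T : Set (Form Var)} (hT : IsTheory Form.mat {A | Axm A} T)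
    {A : Form Var} (hA : A ∉ T)
    (hmax : ∀ U, IsTheory Form.mat {A | Axm A} U → T ⊆ U → A ∉ U → U = T)
    {B : Form Var} (C : Form Var) (hB : B ∉ T) : (B ⊃ₘ C) ∈ T := by
  -- Otherwise the `⊃ₘ`-consequences of `D` over `T` form a theory omitting `A`; by maximality it is
  -- `T`, yet it contains `D`.
  have key : ∀ D, D ∉ T → (D ⊃ₘ A) ∈ T := by
    intro D hD
    by_contra h
    have hU := hmax _ (hT.adjoin_mat D) (fun X hX => hT.mat_mem D hX) h
    have hDD : D ∈ {X | (D ⊃ₘ X) ∈ T} := hT.mp (hT.imp_self_mem D) (hT.subset (.axM1 D D))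
    rw [hU] at hDD
    exact hD hDD
  by_contra h
  -- `axM5` is a form of Peirce's law: from `(B ⊃ₘ C) ⊃ₘ A` and `B ⊃ₘ A` it yields `A`.
  exact hA (hT.imp_mp (key B hB) (hT.imp_mp (key _ h) (hT.subset (.axM5 B C A))))

/-! ### Prime theories -/

/-- A consistent prime theory, with respect to `⇾`, over `Δ`. -/
structure IsPrimeTheory (Δ T : Set (Form Var)) : Prop extends IsTheory Form.imp Δ T where
  bot_notMem : Form.bot ∉ T
  mem_or_mem : ∀ {A B}, (A ⩒ B) ∈ T → A ∈ T ∨ B ∈ T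

section Prime

variable {Δ T : Set (Form Var)}

theorem IsTheory.adjoin_imp (hΔ : ∀ A, Axm A → A ∈ Δ) (hT : IsTheory Form.imp Δ T)
    (B : Form Var) : IsTheory Form.imp Δ {A | (B ⇾ A) ∈ T} where
  subset A hA := hT.mp (hT.subset hA) (hT.subset (hΔ _ (.ax1 A B)))
  mp {A C} hA hAC := hT.mp hA (hT.mp hAC (hT.subset (hΔ _ (.ax2 B A C))))

/-- A theory for `⇾` over `Δ` that omits `A` extends to a consistent prime one. -/
theorem IsTheory.exists_prime (hΔ : IsTheory Form.mat {A | Axm A} Δ)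
    (hT : IsTheory Form.imp Δ T) {A : Form Var} (hA : A ∉ T) :
    ∃ S, T ⊆ S ∧ IsPrimeTheory Δ S ∧ A ∉ S := by
  obtain ⟨S, hTS, hS, hAS, hmax⟩ := hT.exists_maximal hA
  have key : ∀ D, D ∉ S → (D ⇾ A) ∈ S := by
    intro D hD
    by_contra h
    have hU := hmax _ (hS.adjoin_imp (fun _ h => hΔ.subset h) D)
      (fun X hX => hS.mp hX (hS.subset (hΔ.subset (.ax1 X D)))) h
    have hDD : D ∈ {X | (D ⇾ X) ∈ S} := hS.subset (hΔ.imp_self_mem D)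
    rw [hU] at hDD
    exact hD hDD
  refine ⟨S, hTS, ⟨hS, fun h => hAS (hS.mp h (hS.subset (hΔ.subset (.ax0 A)))), ?_⟩, hAS⟩
  intro B C hBC
  by_contra! h
  -- Both disjuncts imply `A` in `S`, so by `ax8` the disjunction would put `A` in `S`.
  exact hAS (hS.mp hBC (hS.mp (key C h.2) (hS.mp (key B h.1)
    (hS.subset (hΔ.subset (.ax8 B C A))))))

end Prime

/-! ### The canonical model -/

/-- The model whose states are the consistent prime theories over `Δ`, ordered by inclusion. -/
def canonicalModel (Δ : Set (Form Var)) (h : ∃ T, IsPrimeTheory Δ T) : Model.{u} Var where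
  W := ULift {T : Set (Form Var) // IsPrimeTheory Δ T}
  nonempty := let ⟨T, hT⟩ := h; ⟨⟨T, hT⟩⟩
  le S T := S.down.1 ⊆ T.down.1
  le_refl _ := subset_rfl
  le_trans _ _ _ h₁ h₂ := h₁.trans h₂
  V T p := Form.var p ∈ T.down.1
  persistent _ _ _ hp h := h hp

/-- Truth lemma, by induction on the formula. Only the `⊃ₘ` case looks beyond one state and its
extensions: it splits on whether the antecedent is in `Δ`. -/
theorem canonicalModel_holds {Δ : Set (Form Var)} (h : ∃ T, IsPrimeTheory Δ T)
    (hΔ : IsTheory Form.mat {A | Axm A} Δ) (hmat : ∀ B C, B ∉ Δ → (B ⊃ₘ C) ∈ Δ)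
    (A : Form Var) :
    ∀ T : (canonicalModel.{u} Δ h).W,
      (canonicalModel.{u} Δ h).Holds T A ↔ A ∈ T.down.1 := by
  have hax (T : (canonicalModel.{u} Δ h).W) {B : Form Var} (hB : Axm B) : B ∈ T.down.1 :=
    T.down.2.subset (hΔ.subset hB)
  have hid : IsTheory Form.imp Δ Δ := ⟨subset_rfl, hΔ.imp_mp⟩
  induction A with
  | var p => exact fun T => Iff.rfl
  | bot => exact fun T => iff_of_false id T.down.2.bot_notMem
  | and A B ihA ihB =>
    intro T
    have hT := T.down.2.toIsTheory
    refine (and_congr (ihA T) (ihB T)).trans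
      ⟨fun ⟨hA, hB⟩ => ?_, fun hAB => ⟨hT.mp hAB (hax T (.ax3 A B)), hT.mp hAB (hax T (.ax4 A B))⟩⟩
    have hK : (A ⇾ B) ∈ T.down.1 := hT.mp hB (hax T (.ax1 B A))
    exact hT.mp hA (hT.mp hK (hT.mp (hT.subset (hΔ.imp_self_mem A)) (hax T (.ax5 A B A))))
  | or A B ihA ihB =>
    intro T
    have hT := T.down.2
    exact (or_congr (ihA T) (ihB T)).trans
      ⟨fun hAB => hAB.elim (fun hA => hT.mp hA (hax T (.ax6 A B)))
        (fun hB => hT.mp hB (hax T (.ax7 A B))), hT.mem_or_mem⟩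
  | imp A B ihA ihB =>
    intro T
    have hT := T.down.2.toIsTheory
    constructor
    · intro hAB
      by_contra hn
      obtain ⟨S, hTS, hS, hBS⟩ :=
        hΔ.exists_prime (hT.adjoin_imp (fun _ h => hΔ.subset h) A) hn
      refine hBS ((ihB ⟨S, hS⟩).1 (hAB ⟨S, hS⟩ ?_ ((ihA ⟨S, hS⟩).2 ?_)))
      · exact fun X hX => hTS (hT.mp hX (hax T (.ax1 X A)))
      · exact hTS (hT.subset (hΔ.imp_self_mem A))
    · exact fun hAB S hTS hA => (ihB S).2 (S.down.2.mp ((ihA S).1 hA) (hTS hAB))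
  | mat A B ihA ihB =>
    intro T
    have hT := T.down.2.toIsTheory
    constructor
    · rintro (⟨S, hS⟩ | hB)
      · exact hT.subset (hmat A B fun hA => hS ((ihA S).2 (S.down.2.subset hA)))
      -- `axM3` turns `A ⊃ₘ (B ⇾ B)` into `B ⇾ (A ⊃ₘ B)`, which is usable inside `T`.
      · exact hT.mp ((ihB T).1 hB) (hT.subset
          (hΔ.imp_mp (hΔ.mat_mem A (hΔ.imp_self_mem B)) (hΔ.subset (.axM3 A B B))))
    · intro hAB
      by_cases hA : A ∈ Δ
      -- Modus ponens for `⊃ₘ` is carried out in `Δ`: `axM4` gives `A ⊃ₘ ((A ⊃ₘ B) ⇾ B)`, so `A ∈ Δ`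
      -- leaves an `⇾` that `T` can detach.
      · refine Or.inr ((ihB T).2 (hT.mp hAB (hT.subset (hΔ.mp hA ?_))))
        exact hΔ.imp_mp (hΔ.imp_self_mem (A ⊃ₘ B)) (hΔ.subset (.axM4 (A ⊃ₘ B) A B))
      · obtain ⟨S, -, hS, hAS⟩ := hΔ.exists_prime hid hA
        exact Or.inl ⟨⟨S, hS⟩, fun h' => hAS ((ihA ⟨S, hS⟩).1 h')⟩

theorem Valid.provable {A : Form Var} (hA : Valid.{u} A) : Provable A := by
  by_contra hn
  obtain ⟨Δ, -, hΔ, hAΔ, hmax⟩ := (isTheory_provable (Var := Var)).exists_maximal hn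
  have hid : IsTheory Form.imp Δ Δ := ⟨subset_rfl, hΔ.imp_mp⟩
  obtain ⟨S, -, hS, hAS⟩ := hΔ.exists_prime hid hAΔ
  have hmat (B C : Form Var) (hB : B ∉ Δ) := hΔ.mat_mem_of_notMem hAΔ hmax C hB
  exact hAS ((canonicalModel_holds.{u} ⟨S, hS⟩ hΔ hmat A ⟨S, hS⟩).1
    (hA _ (fun _ h => h.elim) _))

end SMinusBot

theorem mainTheorem5 {Var : Type} [Countable Var] (A : SMinusBot.Form Var) :
    SMinusBot.Provable A ↔ SMinusBot.Valid.{u} A :=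
  ⟨SMinusBot.Provable.valid, SMinusBot.Valid.provable⟩
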